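/- **Theorem 4.1.** Let $M$ be a matroid without loops on a non-empty finite ground set $E$, with $n=|E|$, and let $L_M$ be its lattice of flats, with least element $\hat 0$ and greatest element $\hat 1=E$. Write $\mathbf 1=(1,\dots,1)\in\mathbb R^E$ and $\mathbb S=\{w\in\mathbb R^E:\sum_i w_i=0,\ \sum_i w_i^2=1\}$. *Bergman fan and complex.* $\widetilde{\mathcal B}(M)$ is the set of all $w\in\mathbb R^E$ such that, for every circuit $C$ of $M$, the minimum of $\{w_i : i\in C\}$ is attained at least twice. It is regarded as a fan whose cones are those cones of the normal fan of the matroid polytope $P_M=\operatorname{conv}\{e_\sigma:\sigma \text{ a basis of } M\}$ (outer normals: the cones of linear forms attaining their maximum over $P_M$ on a given face) whose relative interior contains a point of $\widetilde{\mathcal B}(M)$. The Bergman complex is $\mathcal B(M)=\widetilde{\mathcal B}(M)\cap\mathbb S$; its faces are the intersections of the cones of $\widetilde{\mathcal B}(M)$ with $\mathbb S$. *Building sets and nested sets.* A building set is a set $\mathcal G\subseteq L_M\setminus\{\hat 0\}$ such that, for every $X>\hat 0$ with $G_1,\dots,G_k$ the maximal elements of $\{G\in\mathcal G:G\le X\}$,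 there is an isomorphism of posets $\prod_{j}[\hat 0,G_j]\to[\hat 0,X]$ whose $j$-th component is the inclusion $[\hat 0,G_j]\subseteq[\hat 0,X]$. Let $\mathcal G$ be any building set and put $\widehat{\mathcal G}=\mathcal G\cup\{\hat 1\}$ (so $\widehat{\mathcal G}=\mathcal G$ if $\hat 1\in\mathcal G$). A subset $\mathcal S\subseteq\widehat{\mathcal G}$ is nested if the join of any at least two pairwise incomparable elements of $\mathcal S$ is not in $\widehat{\mathcal G}$. Let $\widetilde{\mathcal N}$ be the simplicial complex of all nested sets and let the nested set complex $\mathcal N(L_M,\mathcal G)$ be the link of $\hat 1$ in $\widetilde{\mathcal N}$. *Nested set fan.* For a flat $F$ let $v_F\in\{0,1\}^E$ be its incidence vector, and for $\mathcal S\in\widetilde{\mathcal N}$ let $V_{\mathcal S}=\mathbb R_{\ge0}\{v_G:G\in\mathcal S\}$. The cones $V_{\mathcal S}$ form $\widetilde\Sigma(L_M,\mathcal G)$. For a flat $F\ne\hat 0,\hat 1$ let $u_F\in\mathbb S$ be obtained from $v_F$ by translating along $\mathbb R\mathbf 1$ and scaling to unit length; $\Sigma(L_M,\mathcal G)$ consists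 of the spherical simplices $\Delta_{\mathcal S}=\mathbb R_{\ge0}\{u_G:G\in\mathcal S\}\cap\mathbb S$ for $\mathcal S\in\mathcal N(L_M,\mathcal G)$. A family of cells refines another one if each cell of the first lies in a cell of the second, and each cell of the second is the union of the cells of the first that it contains. Then: 1. $\widetilde\Sigma(L_M,\mathcal G)$ is a simplicial fan: for $\mathcal S,\mathcal T\in\widetilde{\mathcal N}$ the vectors $v_G$, $G\in\mathcal S$, are linearly independent and $V_{\mathcal S}\cap V_{\mathcal T}=V_{\mathcal S\cap\mathcal T}$. Regarded modulo the line $\mathbb R\mathbf 1$, it refines the Bergman fan: the cones $V_{\mathcal S}+\mathbb R\mathbf 1$, $\mathcal S\in\widetilde{\mathcal N}$, have union $\widetilde{\mathcal B}(M)$, and they refine the cones of $\widetilde{\mathcal B}(M)$. 2. $\Sigma(L_M,\mathcal G)$ is a geometric realization of $\mathcal N(L_M,\mathcal G)$ in $\mathbb S$ and a triangulation of $\mathcal B(M)$: for $\mathcal S,\mathcal T\in\mathcal N(L_M,\mathcal G)$ the points $u_G$, $G\in\mathcal S$, lie in $\mathbb S$ and are linearly independent, $\Delta_{\mathcal S}\cap\Delta_{\mathcal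 T}=\Delta_{\mathcal S\cap\mathcal T}$, the union of all $\Delta_{\mathcal S}$ is $\mathcal B(M)$, and the simplices $\Delta_{\mathcal S}$ refine the faces of $\mathcal B(M)$. -/

import Mathlib

/-! ### The lattice of flats -/

/-- The flats of a matroid, ordered by inclusion. -/
abbrev FlatLattice {E : Type*} (M : Matroid E) : Type _ := {F : Set E // M.IsFlat F}

theorem isFlat_inter_of_isFlat {E : Type*} {M : Matroid E} {F F' : Set E}
    (h : M.IsFlat F) (h' : M.IsFlat F') : M.IsFlat (F ∩ F') := by
  have := Matroid.IsFlat.iInter (M := M) (Fs := fun b : Bool => if b then F else F')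
    (fun b => by cases b <;> simpa)
  rw [Set.inter_eq_iInter]
  convert! this using 3 with b
  cases b <;> rfl

/-- The meet of two flats is their intersection, the join is the span of their union. -/
noncomputable instance flatLatticeInst {E : Type*} (M : Matroid E) : Lattice (FlatLattice M) where
  sup F F' := ⟨M.closure (F.1 ∪ F'.1), M.isFlat_closure _⟩
  inf F F' := ⟨F.1 ∩ F'.1, isFlat_inter_of_isFlat F.2 F'.2⟩
  le_sup_left F F' := Set.subset_union_left.trans
    (M.subset_closure _ (Set.union_subset F.2.subset_ground F'.2.subset_ground))
  le_sup_right F F' := Set.subset_union_right.trans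
    (M.subset_closure _ (Set.union_subset F.2.subset_ground F'.2.subset_ground))
  sup_le _ _ H h h' :=
    (M.closure_subset_closure (Set.union_subset h h')).trans H.2.closure.subset
  inf_le_left _ _ := Set.inter_subset_left
  inf_le_right _ _ := Set.inter_subset_right
  le_inf _ _ _ h h' := Set.subset_inter h h'

/-- The largest flat is the ground set, the smallest one is the span of the empty set. -/
noncomputable instance flatBoundedOrderInst {E : Type*} (M : Matroid E) :
    BoundedOrder (FlatLattice M) where
  top := ⟨M.E, M.ground_isFlat⟩
  le_top F := F.2.subset_ground
  bot := ⟨M.closure ∅, M.isFlat_closure _⟩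
  bot_le F := (M.closure_subset_closure (Set.empty_subset _)).trans F.2.closure.subset

/-! ### Building sets and nested sets in a lattice -/

open Classical in
/-- `G ⊆ L_{> ⊥}` is a building set of `L`: for every `X > ⊥`, with `G₁, …, G_k` the maximal
elements of `G_{≤ X}`, there is an isomorphism of posets `∏ⱼ [⊥, Gⱼ] ≃ [⊥, X]` whose `j`-th
component is the inclusion `[⊥, Gⱼ] ⊆ [⊥, X]`. -/
def IsBuildingSet {L : Type*} [Lattice L] [BoundedOrder L] (G : Set L) : Prop :=
  (∀ g ∈ G, ⊥ < g) ∧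
  ∀ X : L, ⊥ < X →
    ∃ φ : (∀ g : {g : L // Maximal (fun y => y ∈ G ∧ y ≤ X) g}, Set.Iic g.1) ≃o Set.Iic X,
      ∀ (g : {g : L // Maximal (fun y => y ∈ G ∧ y ≤ X) g}) (x : Set.Iic g.1),
        (φ (Function.update ⊥ g x) : L) = (x : L)

/-- `S ⊆ G` is nested: no join of at least two pairwise incomparable elements of `S` is in `G`. -/
def IsNested {L : Type*} [Lattice L] [BoundedOrder L] (G S : Set L) : Prop :=
  S ⊆ G ∧ ∀ T : Finset L, (T : Set L) ⊆ S → IsAntichain (· ≤ ·) (T : Set L) → 2 ≤ T.card →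
    T.sup id ∉ G

/-- The complex of all nested sets (a cone with apex `⊤` when `⊤ ∈ G`). -/
def nestedSets {L : Type*} [Lattice L] [BoundedOrder L] (G : Set L) : Set (Set L) :=
  {S | IsNested G S}

/-- The nested set complex: the link of `⊤` in the complex of all nested sets. -/
def nestedSetComplex {L : Type*} [Lattice L] [BoundedOrder L] (G : Set L) : Set (Set L) :=
  {S | ⊤ ∉ S ∧ IsNested G (insert ⊤ S)}

/-! ### Cones and spherical simplices -/

/-- The cone `ℝ_{≥ 0} {v i | i ∈ S}`. -/
def coneOver {E ι : Type*} (v : ι → E → ℝ) (S : Set ι) : Set (E → ℝ) :=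
  (PointedCone.hull ℝ (v '' S) : Set (E → ℝ))

/-- The set `C + ℝ (1, …, 1)`. -/
def addLine {E : Type*} (C : Set (E → ℝ)) : Set (E → ℝ) :=
  {w | ∃ x ∈ C, ∃ c : ℝ, w = fun i => x i + c}

/-- The sphere `𝕊 = {w | ∑ wᵢ = 0, ∑ wᵢ² = 1}`. -/
def zeroSumSphere (E : Type*) [Fintype E] : Set (E → ℝ) :=
  {w | ∑ i, w i = 0 ∧ ∑ i, w i ^ 2 = 1}

/-- Translate `w` along `ℝ (1, …, 1)` into the hyperplane `∑ wᵢ = 0`, then scale it to unit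
length. -/
noncomputable def toZeroSumSphere {E : Type*} [Fintype E] (w : E → ℝ) : E → ℝ :=
  let x : E → ℝ := fun i => w i - (∑ j, w j) / Fintype.card E
  (√(∑ i, x i ^ 2))⁻¹ • x

/-- The spherical simplex in `𝕊` spanned by the points `u i`, `i ∈ S`. -/
def sphericalSimplex {E ι : Type*} [Fintype E] (u : ι → E → ℝ) (S : Set ι) : Set (E → ℝ) :=
  coneOver u S ∩ zeroSumSphere E

/-- The cones over the faces of `K`, with rays through the vectors `v i`, are simplicial and
intersect along common faces, as prescribed by `K`: they form a simplicial fan. -/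
structure IsSimplicialFan {E ι : Type*} (K : Set (Set ι)) (v : ι → E → ℝ) : Prop where
  linearIndepOn : ∀ S ∈ K, LinearIndepOn ℝ v S
  inter_eq : ∀ S ∈ K, ∀ T ∈ K, coneOver v S ∩ coneOver v T = coneOver v (S ∩ T)

/-- The spherical simplices on the points `u i ∈ 𝕊` indexed by the faces of `K` form a geometric
realization of `K` in `𝕊`. -/
structure IsSphericalRealization {E ι : Type*} [Fintype E] (K : Set (Set ι)) (u : ι → E → ℝ) :
    Prop where
  mem_sphere : ∀ S ∈ K, ∀ i ∈ S, u i ∈ zeroSumSphere E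
  linearIndepOn : ∀ S ∈ K, LinearIndepOn ℝ u S
  inter_eq : ∀ S ∈ K, ∀ T ∈ K,
    sphericalSimplex u S ∩ sphericalSimplex u T = sphericalSimplex u (S ∩ T)

/-- The family `A` of cells refines the family `B`: every cell of `A` lies in a cell of `B`, and
every cell of `B` is the union of the cells of `A` which it contains. (So both have the same
support.) -/
def Refines {V : Type*} (A B : Set (Set V)) : Prop :=
  (∀ a ∈ A, ∃ b ∈ B, a ⊆ b) ∧ ∀ b ∈ B, ⋃₀ {a ∈ A | a ⊆ b} = b

/-! ### The Bergman fan and the Bergman complex of a matroid -/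

/-- The Bergman fan as a set: all `w` such that on every circuit the minimum of `w` is attained at
least twice. -/
def bergmanFan {E : Type*} (M : Matroid E) : Set (E → ℝ) :=
  {w | ∀ C, M.IsCircuit C → ∃ i ∈ C, ∃ j ∈ C, i ≠ j ∧ w i = w j ∧ ∀ k ∈ C, w i ≤ w k}

/-- The Bergman complex as a set. -/
def bergmanComplex {E : Type*} [Fintype E] (M : Matroid E) : Set (E → ℝ) :=
  bergmanFan M ∩ zeroSumSphere E

/-- The 0/1-incidence vector of a set. -/
noncomputable def incidenceVector {E : Type*} (A : Set E) : E → ℝ :=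
  A.indicator (fun _ => (1 : ℝ))

/-- The matroid polytope: the convex hull of the incidence vectors of the bases. -/
def matroidPolytope {E : Type*} (M : Matroid E) : Set (E → ℝ) :=
  convexHull ℝ {x | ∃ B, M.IsBase B ∧ x = incidenceVector B}

/-- The face of `P` at which the linear form `∑ wᵢ xᵢ` attains its maximum. -/
def maxFace {E : Type*} [Fintype E] (P : Set (E → ℝ)) (w : E → ℝ) : Set (E → ℝ) :=
  {x ∈ P | ∀ y ∈ P, ∑ i, w i * y i ≤ ∑ i, w i * x i}

/-- The cone of the normal fan of `P` that has `w` in its relative interior: all linear forms which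
attain their maximum over `P` on the whole face `maxFace P w`. -/
def normalCone {E : Type*} [Fintype E] (P : Set (E → ℝ)) (w : E → ℝ) : Set (E → ℝ) :=
  {w' | maxFace P w ⊆ maxFace P w'}

/-- The cones of the Bergman fan, as a subfan of the normal fan of the matroid polytope. -/
def bergmanCones {E : Type*} [Fintype E] (M : Matroid E) : Set (Set (E → ℝ)) :=
  {C | ∃ w ∈ bergmanFan M, C = normalCone (matroidPolytope M) w}

/-- The faces of the Bergman complex: the cones of the Bergman fan, intersected with `𝕊`. -/
def bergmanFaces {E : Type*} [Fintype E] (M : Matroid E) : Set (Set (E → ℝ)) :=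
  {D | ∃ C ∈ bergmanCones M, D = C ∩ zeroSumSphere E}

/-! ### The nested set fan and its spherical version -/

/-- The vector `v_F` of a flat. In a loopless matroid, `i ∈ F` means that the atom spanned by `i`
is below `F`. -/
noncomputable def flatVector {E : Type*} (M : Matroid E) (F : FlatLattice M) : E → ℝ :=
  incidenceVector F.1

/-- The vertex of the spherical realization which belongs to the flat `F`. -/
noncomputable def flatPoint {E : Type*} [Fintype E] (M : Matroid E) (F : FlatLattice M) : E → ℝ :=
  toZeroSumSphere (flatVector M F)

/-- The cones of the nested set fan, regarded modulo the line `ℝ (1, …, 1)`. -/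
def nestedFanCones {E : Type*} (M : Matroid E) (G : Set (FlatLattice M)) : Set (Set (E → ℝ)) :=
  {C | ∃ S ∈ nestedSets G, C = addLine (coneOver (flatVector M) S)}

/-- The simplices of the spherical realization of the nested set complex. -/
def nestedSimplices {E : Type*} [Fintype E] (M : Matroid E) (G : Set (FlatLattice M)) :
    Set (Set (E → ℝ)) :=
  {D | ∃ S ∈ nestedSetComplex G, D = sphericalSimplex (flatPoint M) S}

/-!
Let `G` be a building set with `⊤` added. Every flat `X` is the disjoint union of its factors, the
maximal members of `G` below `X`, and spans inside `X` can be computed factor by factor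
(`SplitsFlats`, `IsBuildingSet.splitsFlats`). Consequently the members of an antichain in a nested
set are the factors of their join (`SplitsFlats.factors_sup`): a nested set is a laminar family of
sets, unions of its members are flats, and each member has a point that is contained in no smaller
one. The last property makes the incidence vectors linearly independent.

Nested sets and vectors determine each other through superlevel sets. If `w` is a positive
combination of the vectors of a nested set `S`, then its superlevel sets at positive levels are
flats, and `S` consists of the factors of these flats (`SplitsFlats.mem_iff_factor_superlevel`).
Thus `S` can be recovered from `w`, so that cones meet in common faces. Conversely, the Bergman fan
is the set of all `w` whose superlevel sets are flats (`mem_bergmanFan_iff`); for such a `w ≥ 0` the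
factors of the superlevel sets form a nested set (`isNested_superlevel_factors`) whose cone contains
`w`. So the cones cover exactly the Bergman fan.

For the comparison with the normal fan of the matroid polytope, let `w` be in the Bergman fan. A
basis of largest `w`-weight among those through a given element spans every superlevel set, hence
every factor of these, and so maximizes all vectors of the nested set of `w` at once
(`SplitsFlats.exists_isBase_spanning`). Therefore a point of the polytope maximizes `w` if and only
if it maximizes all these vectors, and the normal cone of `w` contains the whole cone of its nested
set. Since these bases cover the ground set, and a weight for which the maximal bases cover the
ground set lies in the Bergman fan (`mem_bergmanFan_of_forall_exists_isBase`), normal cones of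
vectors in the Bergman fan stay inside it; this gives the refinement.

The spherical statements follow by intersection with the sphere: the simplex of `S` is cut out by
the cone of `S ∪ {⊤}` modulo the line, because the vector of `⊤` is `(1, …, 1)`
(`sphericalSimplex_flatPoint`).
-/

open Set

/-! ### Factors with respect to a building set -/

section Lattice

variable {L : Type*} [Lattice L] {G : Set L} {X : L}

/-- The factors of `X` with respect to `G`: the maximal elements of `G` below `X`. -/
def factors (G : Set L) (X : L) : Set L := {g | Maximal (fun y => y ∈ G ∧ y ≤ X) g}

theorem factors_of_mem (hX : X ∈ G) : factors G X = {X} := by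
  ext g
  constructor
  · intro hg
    exact le_antisymm hg.1.2 (hg.2 ⟨hX, le_rfl⟩ hg.1.2)
  · rintro rfl
    exact ⟨⟨hX, le_rfl⟩, fun y hy _ => hy.2⟩

theorem exists_factor_ge [Finite L] {y : L} (hy : y ∈ G) (hyX : y ≤ X) :
    ∃ g ∈ factors G X, y ≤ g := by
  obtain ⟨g, hyg, hg⟩ := (Set.toFinite {y | y ∈ G ∧ y ≤ X}).exists_le_maximal ⟨hy, hyX⟩
  exact ⟨g, hg, hyg⟩

variable [BoundedOrder L]

open Classical in
/-- The isomorphism onto `[⊥, X]` dominates every coordinate. -/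
theorem apply_le_of_update {φ : (∀ g : {g : L // Maximal (fun y => y ∈ G ∧ y ≤ X) g},
      Set.Iic g.1) ≃o Set.Iic X}
    (hφ : ∀ (g : {g : L // Maximal (fun y => y ∈ G ∧ y ≤ X) g}) (x : Set.Iic g.1),
        (φ (Function.update ⊥ g x) : L) = (x : L))
    (x : ∀ g : {g : L // Maximal (fun y => y ∈ G ∧ y ≤ X) g}, Set.Iic g.1) (g) :
    (x g : L) ≤ φ x := by
  rw [← hφ g (x g)]
  have : Function.update ⊥ g (x g) ≤ x := by
    rw [update_le_iff]
    exact ⟨le_rfl, fun j _ => bot_le⟩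
  exact φ.monotone this

open Classical in
/-- An element below one factor has no component in the others. -/
theorem symm_apply_of_update {φ : (∀ g : {g : L // Maximal (fun y => y ∈ G ∧ y ≤ X) g},
      Set.Iic g.1) ≃o Set.Iic X}
    (hφ : ∀ (g : {g : L // Maximal (fun y => y ∈ G ∧ y ≤ X) g}) (x : Set.Iic g.1),
        (φ (Function.update ⊥ g x) : L) = (x : L)) (g) (y : Set.Iic X) (hy : (y : L) ≤ g.1) :
    φ.symm y = Function.update ⊥ g ⟨y, hy⟩ := by
  rw [OrderIso.symm_apply_eq]
  exact Subtype.ext (hφ g ⟨y, hy⟩).symm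

theorem IsBuildingSet.disjoint_factors (hG : IsBuildingSet G) (hX : ⊥ < X) {g h : L}
    (hg : g ∈ factors G X) (hh : h ∈ factors G X) (hgh : g ≠ h) : Disjoint g h := by
  classical
  obtain ⟨φ, hφ⟩ := hG.2 X hX
  rw [disjoint_iff_inf_le]
  let y : Set.Iic X := ⟨g ⊓ h, inf_le_left.trans hg.1.2⟩
  have h1 := symm_apply_of_update hφ ⟨g, hg⟩ y inf_le_left
  have h2 := symm_apply_of_update hφ ⟨h, hh⟩ y inf_le_right
  have h3 := congrFun (h1.symm.trans h2) ⟨g, hg⟩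
  rw [Function.update_self, Function.update_of_ne (fun h' => hgh (congrArg Subtype.val h'))] at h3
  exact (congrArg Subtype.val h3).le

/-- Every nonzero element below `X` meets some factor of `X`. -/
theorem IsBuildingSet.exists_le_factor (hG : IsBuildingSet G) (hX : ⊥ < X) {y : L} (hy : y ≤ X)
    (hy0 : y ≠ ⊥) : ∃ g ∈ factors G X, ∃ z ≤ g, z ≤ y ∧ z ≠ ⊥ := by
  classical
  obtain ⟨φ, hφ⟩ := hG.2 X hX
  by_contra! hcon
  apply hy0
  have h0 : φ.symm ⟨y, hy⟩ = ⊥ := by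
    funext g
    refine Subtype.ext (hcon g.1 g.2 _ (φ.symm ⟨y, hy⟩ g).2 ?_)
    have := apply_le_of_update hφ (φ.symm ⟨y, hy⟩) g
    simpa using this
  rw [OrderIso.symm_apply_eq, OrderIso.map_bot] at h0
  exact congrArg Subtype.val h0

/-- Elements below one factor only see the component of a join in that factor. -/
theorem IsBuildingSet.le_component (hG : IsBuildingSet G) (hX : ⊥ < X) {x : L → L}
    (hx : ∀ g ∈ factors G X, x g ≤ g) {h e : L} (hh : h ∈ factors G X) (heh : e ≤ h)
    (he : ∀ u ≤ X, (∀ g ∈ factors G X, x g ≤ u) → e ≤ u) : e ≤ x h := by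
  classical
  obtain ⟨φ, hφ⟩ := hG.2 X hX
  let x' : ∀ g : {g : L // Maximal (fun y => y ∈ G ∧ y ≤ X) g}, Set.Iic g.1 :=
    fun g => ⟨x g.1, hx g.1 g.2⟩
  have h1 : e ≤ φ x' := he _ (φ x').2 fun g hg => apply_le_of_update hφ x' ⟨g, hg⟩
  have h2 : (⟨e, heh.trans hh.1.2⟩ : Set.Iic X) ≤ φ x' := h1
  rw [← OrderIso.symm_apply_le, symm_apply_of_update hφ ⟨h, hh⟩ _ heh] at h2
  have h3 := h2 ⟨h, hh⟩
  rw [Function.update_self] at h3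
  exact h3

theorem IsNested.subset {S T : Set L} (hS : IsNested G S) (h : T ⊆ S) : IsNested G T :=
  ⟨h.trans hS.1, fun U hU => hS.2 U (hU.trans h)⟩

theorem IsNested.insert_top {S : Set L} (hS : IsNested G S) (h : ⊤ ∈ G) :
    IsNested G (insert ⊤ S) := by
  refine ⟨Set.insert_subset h hS.1, fun T hT hA hc => hS.2 T (fun g hg => ?_) hA hc⟩
  rcases hT hg with rfl | h'
  · obtain ⟨g', hg', hne⟩ := Finset.exists_mem_ne (by omega : 1 < T.card) ⊤
    exact absurd le_top (hA hg' hg hne)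
  · exact h'

end Lattice

/-! ### Factors of flats -/

section Flats

variable {E : Type*} {M : Matroid E} {G : Set (FlatLattice M)}

/-- The properties of a building set of the lattice of flats, with the maximal element added, which
are used for the fan: every flat is the disjoint union of its factors, and spans can be computed
factor by factor. -/
structure SplitsFlats (M : Matroid E) (G : Set (FlatLattice M)) : Prop where
  top_mem : ⊤ ∈ G
  nonempty : ∀ g ∈ G, g.1.Nonempty
  exists_mem : ∀ X : FlatLattice M, ∀ i ∈ X.1, ∃ g ∈ factors G X, i ∈ g.1
  disjoint : ∀ X, ∀ g ∈ factors G X, ∀ h ∈ factors G X, g ≠ h → Disjoint g.1 h.1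
  mem_closure : ∀ X : FlatLattice M, ∀ g ∈ factors G X, ∀ A ⊆ X.1, ∀ e ∈ g.1, e ∈ M.closure A →
    e ∈ M.closure (A ∩ g.1)

theorem flat_bot [M.Loopless] : (⊥ : FlatLattice M).1 = ∅ := by
  change M.closure ∅ = ∅
  rw [M.closure_empty, M.loops_eq_empty]

theorem flat_eq_bot_iff [M.Loopless] {X : FlatLattice M} : X = ⊥ ↔ X.1 = ∅ := by
  rw [← flat_bot (M := M), Subtype.ext_iff]

theorem flat_le_iff {X Y : FlatLattice M} : X ≤ Y ↔ X.1 ⊆ Y.1 := Iff.rfl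

theorem closure_subset_flat (X : FlatLattice M) {A : Set E} (hA : A ⊆ X.1) :
    M.closure A ⊆ X.1 :=
  (M.closure_subset_closure hA).trans X.2.closure.subset

theorem IsBuildingSet.exists_mem_factor [M.Loopless] (hG : IsBuildingSet G) (X : FlatLattice M)
    {i : E} (hi : i ∈ X.1) : ∃ g ∈ factors G X, i ∈ g.1 := by
  have hX : ⊥ < X := bot_lt_iff_ne_bot.2 fun h => by simp [flat_eq_bot_iff.1 h] at hi
  have hiE : i ∈ M.E := X.2.subset_ground hi
  let y : FlatLattice M := ⟨M.closure {i}, M.isFlat_closure _⟩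
  have hiy : i ∈ y.1 := M.mem_closure_of_mem rfl (by simpa)
  have hy : y ≤ X := closure_subset_flat X (by simpa)
  obtain ⟨g, hg, z, hzg, hzy, hz0⟩ := hG.exists_le_factor hX hy
    (fun h => by simp [flat_eq_bot_iff.1 h] at hiy)
  refine ⟨g, hg, ?_⟩
  obtain ⟨j, hj⟩ := Set.nonempty_iff_ne_empty.2 (fun h => hz0 (flat_eq_bot_iff.2 h))
  -- `i` and `j` are parallel, so that `z` is the span of `i`
  have hji : j ∈ M.closure (insert i ∅) \ M.closure ∅ := by
    exact ⟨by simpa using hzy hj, by simp [M.closure_empty]⟩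
  have hij := (Matroid.closure_exchange hji).1
  exact closure_subset_flat g (by simpa using hzg hj) hij

/-- Adding `⊤` changes the factors of no flat other than `⊤`, whose only factor is then `⊤`
itself. -/
theorem IsBuildingSet.splitsFlats [M.Loopless] (hE : M.E.Nonempty) (hG : IsBuildingSet G) :
    SplitsFlats M (insert ⊤ G) := by
  have hpos : ∀ X : FlatLattice M, X.1.Nonempty → ⊥ < X := fun X h =>
    bot_lt_iff_ne_bot.2 fun h' => h.ne_empty (flat_eq_bot_iff.1 h')
  have htop : factors (insert ⊤ G) (⊤ : FlatLattice M) = {⊤} := factors_of_mem (mem_insert _ _)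
  have hne : ∀ X : FlatLattice M, X ≠ ⊤ → factors (insert ⊤ G) X = factors G X := by
    intro X hX
    have : ∀ y, (y ∈ insert ⊤ G ∧ y ≤ X) ↔ (y ∈ G ∧ y ≤ X) := fun y => by
      constructor
      · rintro ⟨rfl | h, h'⟩
        · exact absurd (top_le_iff.1 h') hX
        · exact ⟨h, h'⟩
      · exact fun h => ⟨Or.inr h.1, h.2⟩
    simp only [factors, this]
  refine ⟨mem_insert _ _, ?_, ?_, ?_, ?_⟩
  · rintro g (rfl | hg)
    · exact hE
    · exact Set.nonempty_iff_ne_empty.2 fun h => (hG.1 g hg).ne' (flat_eq_bot_iff.2 h)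
  · intro X i hi
    by_cases hX : X = ⊤
    · subst hX
      exact ⟨⊤, by simp [htop], hi⟩
    · rw [hne X hX]
      exact hG.exists_mem_factor X hi
  · intro X g hg h hh hgh
    by_cases hX : X = ⊤
    · subst hX
      rw [htop] at hg hh
      exact absurd (hg.trans hh.symm) hgh
    · rw [hne X hX] at hg hh
      rw [Set.disjoint_left]
      intro i hig hih
      have hd := hG.disjoint_factors (hpos X ⟨i, hg.1.2 hig⟩) hg hh hgh
      have : g ⊓ h = ⊥ := hd.eq_bot
      have := flat_eq_bot_iff.1 this
      exact (this ▸ (⟨hig, hih⟩ : i ∈ (g ⊓ h).1) : i ∈ (∅ : Set E))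
  · intro X g hg A hA e he heA
    by_cases hX : X = ⊤
    · subst hX
      rw [htop] at hg
      obtain rfl : g = ⊤ := hg
      have hA' : A ∩ (⊤ : FlatLattice M).1 = A := inter_eq_left.2 hA
      rwa [hA']
    · rw [hne X hX] at hg
      have hAE : A ⊆ M.E := hA.trans X.2.subset_ground
      have heE : e ∈ M.E := g.2.subset_ground he
      let x : FlatLattice M → FlatLattice M := fun h => ⟨M.closure (A ∩ h.1), M.isFlat_closure _⟩
      have key := hG.le_component (hpos X ⟨e, hg.1.2 he⟩) (x := x)
        (fun h _ => closure_subset_flat h inter_subset_right) hg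
        (e := ⟨M.closure {e}, M.isFlat_closure _⟩) (closure_subset_flat g (by simpa)) ?_
      · exact key (M.mem_closure_of_mem rfl (by simpa) : e ∈ M.closure {e})
      · intro u hu hxu
        have hAu : A ⊆ u.1 := by
          intro i hi
          obtain ⟨h, hh, hih⟩ := hG.exists_mem_factor X (hA hi)
          exact hxu h hh (M.mem_closure_of_mem ⟨hi, hih⟩ (inter_subset_left.trans hAE))
        exact closure_subset_flat u
          (by simpa using closure_subset_flat u hAu heA)

end Flats

/-! ### Nested sets of flats and their positive combinations -/

section Nested

variable {E : Type*} [Finite E] {M : Matroid E} [M.Loopless] {G S : Set (FlatLattice M)}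

/-- In a nested set, the members of an antichain are the factors of their join. -/
theorem SplitsFlats.factors_sup (hG : SplitsFlats M G) (hS : IsNested G S)
    {T : Finset (FlatLattice M)} (hTS : (T : Set (FlatLattice M)) ⊆ S)
    (hT : IsAntichain (· ≤ ·) (T : Set (FlatLattice M))) :
    factors G (T.sup id) = (T : Set (FlatLattice M)) := by
  classical
  have hfac : ∀ g ∈ T, ∃ h ∈ factors G (T.sup id), g ≤ h := fun g hg =>
    exists_factor_ge (hS.1 (hTS hg)) (Finset.le_sup (f := id) hg)
  have hsub : factors G (T.sup id) ⊆ (T : Set (FlatLattice M)) := by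
    intro h hh
    let A : Set E := ⋃ g ∈ T, g.1
    have hAY : A ⊆ (T.sup id).1 := iUnion₂_subset fun g hg => Finset.le_sup (f := id) hg
    have hYA : (T.sup id).1 ⊆ M.closure A := by
      have : T.sup id ≤ (⟨M.closure A, M.isFlat_closure _⟩ : FlatLattice M) :=
        Finset.sup_le fun g hg => (M.subset_closure g.1 g.2.subset_ground).trans
          (M.closure_subset_closure (subset_biUnion_of_mem (u := fun g : FlatLattice M => g.1) hg))
      exact this
    have hle : h ≤ (T.filter (· ≤ h)).sup id := by
      intro e he
      have he' := hG.mem_closure _ h hh A hAY e he (hYA (hh.1.2 he))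
      refine closure_subset_flat _ ?_ he'
      rintro x ⟨hxA, hxh⟩
      obtain ⟨g, hgT, hxg⟩ := mem_iUnion₂.1 hxA
      obtain ⟨h', hh', hgh'⟩ := hfac g hgT
      have : h' = h := by
        by_contra hne
        exact Set.disjoint_left.1 (hG.disjoint _ _ hh' _ hh hne) (hgh' hxg) hxh
      subst this
      exact Finset.le_sup (f := id) (Finset.mem_filter.2 ⟨hgT, hgh'⟩) hxg
    have heq : (T.filter (· ≤ h)).sup id = h :=
      le_antisymm (Finset.sup_le fun g hg => (Finset.mem_filter.1 hg).2) hle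
    have hcard : (T.filter (· ≤ h)).card < 2 := by
      by_contra! hc
      refine hS.2 _ (Subset.trans ?_ hTS) (hT.subset ?_) hc (by rw [heq]; exact hh.1.1)
      all_goals exact_mod_cast Finset.filter_subset _ _
    rcases Nat.lt_succ_iff.1 hcard |>.lt_or_eq with h0 | h1
    · rw [Nat.lt_one_iff, Finset.card_eq_zero] at h0
      rw [h0, Finset.sup_empty] at heq
      exact absurd (flat_eq_bot_iff.1 heq.symm) (hG.nonempty h hh.1.1).ne_empty
    · obtain ⟨g, hg⟩ := Finset.card_eq_one.1 h1
      rw [hg, Finset.sup_singleton] at heq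
      obtain rfl : g = h := heq
      exact (Finset.mem_filter.1 (hg ▸ Finset.mem_singleton_self g : g ∈ T.filter (· ≤ g))).1
  refine hsub.antisymm fun g hg => ?_
  obtain ⟨h, hh, hgh⟩ := hfac g hg
  rwa [hT.eq hg (hsub hh) hgh]

/-- A union of members of a nested set is a flat, whose factors are the maximal ones of these
members. -/
theorem SplitsFlats.exists_flat_eq_biUnion (hG : SplitsFlats M G) (hS : IsNested G S)
    {A : Set (FlatLattice M)} (hA : A ⊆ S) :
    ∃ Y : FlatLattice M, Y.1 = ⋃ g ∈ A, g.1 ∧ ∀ g, g ∈ factors G Y ↔ Maximal (· ∈ A) g := by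
  classical
  let T : Finset (FlatLattice M) := (Set.toFinite {g | Maximal (· ∈ A) g}).toFinset
  have hT : (T : Set (FlatLattice M)) = {g | Maximal (· ∈ A) g} := by simp [T]
  have hfac := hG.factors_sup hS (T := T) (by rw [hT]; exact fun g hg => hA hg.1)
    (by rw [hT]; exact setOfPred_maximal_antichain _)
  rw [hT] at hfac
  refine ⟨T.sup id, ?_, fun g => by rw [hfac]; rfl⟩
  apply subset_antisymm
  · intro i hi
    obtain ⟨g, hg, hig⟩ := hG.exists_mem _ i hi
    rw [hfac] at hg
    exact mem_biUnion hg.1 hig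
  · refine iUnion₂_subset fun g hg => ?_
    obtain ⟨g', hgg', hg'⟩ := (Set.toFinite A).exists_le_maximal hg
    have : g' ∈ T := by
      rw [← Finset.mem_coe, hT]
      exact hg'
    exact hgg'.trans (Finset.le_sup (f := id) this)

/-- Members of a nested set with a common point are comparable. -/
theorem SplitsFlats.laminar (hG : SplitsFlats M G) (hS : IsNested G S) {g h : FlatLattice M}
    (hg : g ∈ S) (hh : h ∈ S) {i : E} (hig : i ∈ g.1) (hih : i ∈ h.1) : g ≤ h ∨ h ≤ g := by
  by_contra! hcon
  obtain ⟨Y, -, hY⟩ := hG.exists_flat_eq_biUnion hS (A := {g, h})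
    (insert_subset hg (singleton_subset_iff.2 hh))
  have h1 : g ∈ factors G Y := (hY g).2 ⟨Or.inl rfl, by
    rintro x (rfl | rfl) hx
    · exact le_rfl
    · exact absurd hx hcon.1⟩
  have h2 : h ∈ factors G Y := (hY h).2 ⟨Or.inr rfl, by
    rintro x (rfl | rfl) hx
    · exact absurd hx hcon.2
    · exact le_rfl⟩
  exact Set.disjoint_left.1 (hG.disjoint Y g h1 h h2 fun h => hcon.1 h.le) hig hih

/-- Every member `g` of a nested set has a point which lies only in the members above `g`. -/
theorem SplitsFlats.exists_private (hG : SplitsFlats M G) (hS : IsNested G S)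
    {g : FlatLattice M} (hg : g ∈ S) : ∃ i ∈ g.1, ∀ h ∈ S, i ∈ h.1 → g ≤ h := by
  obtain ⟨Y, hYA, hY⟩ := hG.exists_flat_eq_biUnion hS (A := {h | h ∈ S ∧ h < g}) fun h hh => hh.1
  by_contra! hcon
  -- otherwise `g` is the union of the smaller members, so that these contain a factor of `g ∈ G`
  have hYg : Y = g := by
    refine Subtype.ext (hYA.trans (subset_antisymm (iUnion₂_subset fun h hh => hh.2.le) ?_))
    intro i hi
    obtain ⟨h, hh, hih, hgh⟩ := hcon i hi
    have hle := (hG.laminar hS hg hh hi hih).resolve_left hgh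
    exact mem_biUnion (show h ∈ {h | h ∈ S ∧ h < g} from ⟨hh, lt_of_le_not_ge hle hgh⟩) hih
  have hgY : g ∈ factors G Y := by
    rw [hYg, factors_of_mem (hS.1 hg)]
    rfl
  exact lt_irrefl _ ((hY g).1 hgY).1.2

omit [Finite E] [M.Loopless] in
open Classical in
theorem sum_flatVector_apply (T : Finset (FlatLattice M)) (a : FlatLattice M → ℝ) (i : E) :
    (∑ g ∈ T, a g • flatVector M g) i = ∑ g ∈ T with i ∈ g.1, a g := by
  rw [Finset.sum_apply, Finset.sum_filter]
  refine Finset.sum_congr rfl fun g _ => ?_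
  simp [flatVector, incidenceVector, Set.indicator_apply]

theorem SplitsFlats.linearIndepOn (hG : SplitsFlats M G) (hS : IsNested G S) :
    LinearIndepOn ℝ (flatVector M) S := by
  classical
  rw [linearIndepOn_iff']
  intro T a hTS hsum
  by_contra! hcon
  obtain ⟨g₀, hg₀⟩ := hcon
  obtain ⟨g, -, hg⟩ := (Set.toFinite {g | g ∈ T ∧ a g ≠ 0}).exists_le_maximal hg₀
  obtain ⟨i, hi, hmin⟩ := hG.exists_private hS (hTS hg.1.1)
  -- at a private point of a maximal `g` with `a g ≠ 0`, the sum takes the value `a g`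
  have h1 := congrFun hsum i
  rw [sum_flatVector_apply, Finset.sum_eq_single g] at h1
  · exact hg.1.2 h1
  · intro h hh hne
    rw [Finset.mem_filter] at hh
    by_contra h0
    have hgh := hmin h (hTS hh.1) hh.2
    exact hne (le_antisymm (hg.2 ⟨hh.1, h0⟩ hgh) hgh)
  · intro h
    exact absurd (Finset.mem_filter.2 ⟨hg.1.1, hi⟩) h

open Classical in
/-- The superlevel sets of a nonnegative combination of the vectors of a nested set are flats with
factors in the nested set. A factor `g` is a maximal member on which the combination, whose minimum
on `g` is the sum of the coefficients of all larger members, is at least `t`. -/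
theorem SplitsFlats.superlevel (hG : SplitsFlats M G) {T : Finset (FlatLattice M)}
    (hT : IsNested G (T : Set (FlatLattice M))) {a : FlatLattice M → ℝ} (ha : ∀ g ∈ T, 0 ≤ a g)
    {t : ℝ} (ht : 0 < t) :
    ∃ Y : FlatLattice M, Y.1 = {i | t ≤ (∑ g ∈ T, a g • flatVector M g) i} ∧
      ∀ g, g ∈ factors G Y ↔ Maximal (fun g => g ∈ T ∧ t ≤ ∑ h ∈ T with g ≤ h, a h) g := by
  obtain ⟨Y, hYA, hY⟩ := hG.exists_flat_eq_biUnion hT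
    (A := {g | g ∈ T ∧ t ≤ ∑ h ∈ T with g ≤ h, a h}) fun g hg => hg.1
  refine ⟨Y, hYA.trans ?_, hY⟩
  ext i
  simp only [mem_iUnion, mem_ofPred_eq, sum_flatVector_apply]
  constructor
  · rintro ⟨g, ⟨hg, hgt⟩, hig⟩
    refine hgt.trans (Finset.sum_le_sum_of_subset_of_nonneg ?_ ?_)
    · exact Finset.monotone_filter_right _ fun h _ (hgh : g ≤ h) => hgh hig
    · exact fun h hh _ => ha h (Finset.mem_filter.1 hh).1
  · intro hti
    have hne : (T.filter (i ∈ ·.1)).Nonempty := by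
      by_contra hemp
      rw [Finset.not_nonempty_iff_eq_empty] at hemp
      rw [hemp, Finset.sum_empty] at hti
      exact absurd ht hti.not_gt
    obtain ⟨g, hg⟩ := (T.filter (i ∈ ·.1)).exists_minimal hne
    have hg' := Finset.mem_filter.1 hg.1
    refine ⟨g, ⟨hg'.1, hti.trans_eq ?_⟩, hg'.2⟩
    congr 1
    ext h
    simp only [Finset.mem_filter, and_congr_right_iff]
    intro hh
    refine ⟨fun hih => ?_, fun hgh => hgh hg'.2⟩
    rcases hG.laminar hT hg'.1 hh hg'.2 hih with h1 | h1
    · exact h1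
    · exact hg.2 (Finset.mem_filter.2 ⟨hh, hih⟩) h1

/-- A nested set can be recovered from a positive combination of its vectors: it consists of the
factors of the superlevel sets. -/
theorem SplitsFlats.mem_iff_factor_superlevel (hG : SplitsFlats M G) {T : Finset (FlatLattice M)}
    (hT : IsNested G (T : Set (FlatLattice M))) {a : FlatLattice M → ℝ} (ha : ∀ g ∈ T, 0 < a g)
    (g : FlatLattice M) :
    g ∈ T ↔ ∃ t > 0, ∃ Y : FlatLattice M, Y.1 = {i | t ≤ (∑ g ∈ T, a g • flatVector M g) i} ∧
      g ∈ factors G Y := by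
  classical
  constructor
  · intro hg
    have hpos : 0 < ∑ h ∈ T with g ≤ h, a h :=
      Finset.sum_pos (fun h hh => ha h (Finset.mem_filter.1 hh).1)
        ⟨g, Finset.mem_filter.2 ⟨hg, le_rfl⟩⟩
    obtain ⟨Y, hY, hfac⟩ := hG.superlevel hT (fun g hg => (ha g hg).le) hpos
    refine ⟨_, hpos, Y, hY, (hfac g).2 ⟨⟨hg, le_rfl⟩, fun h hh hgh => ?_⟩⟩
    by_contra hhg
    -- the sum for a larger member lacks the positive term `a g`
    refine hh.2.not_gt (Finset.sum_lt_sum_of_subset (i := g) ?_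
      (Finset.mem_filter.2 ⟨hg, le_rfl⟩) (by simp [hhg]) (ha g hg)
      fun j hj _ => (ha j (Finset.mem_filter.1 hj).1).le)
    exact Finset.monotone_filter_right _ fun k _ (hk : h ≤ k) => hgh.trans hk
  · rintro ⟨t, ht, Y, hY, hg⟩
    obtain ⟨Y', hY', hfac⟩ := hG.superlevel hT (fun g hg => (ha g hg).le) ht
    obtain rfl : Y = Y' := Subtype.ext (hY.trans hY'.symm)
    exact ((hfac g).1 hg).1.1

theorem SplitsFlats.eq_of_sum_eq (hG : SplitsFlats M G) {T U : Finset (FlatLattice M)}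
    (hT : IsNested G (T : Set (FlatLattice M))) (hU : IsNested G (U : Set (FlatLattice M)))
    {a b : FlatLattice M → ℝ} (ha : ∀ g ∈ T, 0 < a g) (hb : ∀ g ∈ U, 0 < b g)
    (h : ∑ g ∈ T, a g • flatVector M g = ∑ g ∈ U, b g • flatVector M g) : T = U := by
  ext g
  rw [hG.mem_iff_factor_superlevel hT ha, hG.mem_iff_factor_superlevel hU hb, h]

end Nested

/-! ### Cones -/

section Cones

variable {E : Type*}

/-- The points of a cone are the positive combinations of finite subsets of the generators. Passing
to the support of the coefficients is what makes these combinations strictly positive. -/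
theorem mem_coneOver_iff {ι : Type*} {v : ι → E → ℝ} {S : Set ι} {w : E → ℝ} :
    w ∈ coneOver v S ↔ ∃ T : Finset ι, (T : Set ι) ⊆ S ∧ ∃ a : ι → ℝ, (∀ i ∈ T, 0 < a i) ∧
      w = ∑ i ∈ T, a i • v i := by
  constructor
  · intro hw
    obtain ⟨l, hl, rfl⟩ := (Finsupp.mem_span_image_iff_linearCombination _).1 hw
    refine ⟨l.support, hl, fun i => (l i : ℝ), fun i hi => ?_, ?_⟩
    · exact lt_of_le_of_ne (l i).2 fun h => Finsupp.mem_support_iff.1 hi (Subtype.ext h.symm)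
    · rw [Finsupp.linearCombination_apply]
      rfl
  · rintro ⟨T, hT, a, ha, rfl⟩
    refine Submodule.sum_mem _ fun i hi => PointedCone.smul_mem _ (ha i hi).le ?_
    exact Submodule.subset_span ⟨i, hT hi, rfl⟩

theorem coneOver_mono {ι : Type*} {v : ι → E → ℝ} {S T : Set ι} (h : S ⊆ T) :
    coneOver v S ⊆ coneOver v T := Submodule.span_mono (image_mono h)

/-- A nonnegative vector lies in every cone which contains the indicators of its superlevel sets at
positive levels. -/
theorem mem_pointedCone_of_superlevel [Finite E] (K : PointedCone ℝ (E → ℝ)) {w : E → ℝ}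
    (hw : 0 ≤ w) (hK : ∀ t > 0, incidenceVector {i | t ≤ w i} ∈ K) : w ∈ K := by
  induction hn : {i | 0 < w i}.ncard using Nat.strong_induction_on generalizing w with
  | _ n ih =>
  by_cases hemp : {i | 0 < w i} = ∅
  · have : w = 0 := by
      funext i
      by_contra h
      exact (hemp ▸ lt_of_le_of_ne (hw i) (Ne.symm h) : i ∈ (∅ : Set E))
    rw [this]
    exact K.zero_mem
  -- subtract the smallest positive value of `w` on its support
  obtain ⟨p, hp, hmin⟩ := Set.exists_min_image {i | 0 < w i} w (Set.toFinite _)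
    (Set.nonempty_iff_ne_empty.2 hemp)
  have hp : 0 < w p := hp
  let x : E → ℝ := incidenceVector {i | w p ≤ w i}
  have hx1 : ∀ i, w p ≤ w i → x i = 1 := fun i hi => Set.indicator_of_mem (s := {i | w p ≤ w i}) hi _
  have hx0 : ∀ i, ¬ w p ≤ w i → x i = 0 := fun i hi =>
    Set.indicator_of_notMem (s := {i | w p ≤ w i}) hi _
  have hw0 : ∀ i, ¬ w p ≤ w i → w i = 0 := fun i hi => by
    by_contra h
    exact hi (hmin i (lt_of_le_of_ne (hw i) (Ne.symm h)))
  have hdec : w = (w - w p • x) + w p • x := by simp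
  rw [hdec]
  refine K.add_mem ?_ (PointedCone.smul_mem _ hp.le (hK _ hp))
  have hval : ∀ i, (w p ≤ w i ∧ (w - w p • x) i = w i - w p) ∨
      (w i = 0 ∧ (w - w p • x) i = 0) := by
    intro i
    by_cases hi : w p ≤ w i
    · exact Or.inl ⟨hi, by simp [hx1 i hi]⟩
    · exact Or.inr ⟨hw0 i hi, by simp [hx0 i hi, hw0 i hi]⟩
  refine ih _ ?_ ?_ ?_ rfl
  · rw [← hn]
    refine Set.ncard_lt_ncard ⟨fun i hi => ?_, fun h => ?_⟩ (Set.toFinite _)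
    · have hi : 0 < (w - w p • x) i := hi
      change 0 < w i
      rcases hval i with h | h <;> linarith [h.1, h.2]
    · have hpp : 0 < (w - w p • x) p := h hp
      rcases hval p with h | h <;> linarith [h.1, h.2]
  · intro i
    change 0 ≤ (w - w p • x) i
    rcases hval i with h | h <;> linarith [h.1, h.2]
  · intro t ht
    convert hK (t + w p) (by linarith) using 2
    ext i
    change t ≤ (w - w p • x) i ↔ t + w p ≤ w i
    rcases hval i with h | h <;> constructor <;> intro <;> linarith [h.1, h.2]

end Cones

/-! ### The Bergman fan and the superlevel sets of its vectors -/

section Bergman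

variable {E : Type*} [Fintype E] {M : Matroid E} [M.Loopless]

/-- The Bergman fan consists of the vectors all of whose superlevel sets are flats. -/
theorem mem_bergmanFan_iff (hE : M.E = univ) {w : E → ℝ} :
    w ∈ bergmanFan M ↔ ∀ t, M.IsFlat {i | t ≤ w i} := by
  constructor
  · intro hw t
    rw [Matroid.isFlat_iff_closure_eq]
    refine subset_antisymm (fun i hi => ?_) (M.subset_closure _ (by simp [hE]))
    by_contra hiX
    obtain ⟨C, hCX, hC, hiC⟩ := Matroid.exists_isCircuit_of_mem_closure hi hiX
    obtain ⟨p, hp, q, hq, hpq, hwpq, hmin⟩ := hw C hC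
    apply hiX
    change t ≤ w i
    -- one of the two minimizers on the circuit lies in the superlevel set
    rcases hCX hp with rfl | hp'
    · rcases hCX hq with rfl | hq'
      · exact absurd rfl hpq
      · exact hwpq ▸ hq'
    · exact le_trans hp' (hmin i hiC)
  · intro hw C hC
    obtain ⟨p, hp, hmin⟩ := Set.exists_min_image C w (Set.toFinite _) hC.nonempty
    have hpcl := hC.mem_closure_sdiff_singleton_of_mem hp
    have hne : (C \ {p}).Nonempty := by
      rw [Set.nonempty_iff_ne_empty]
      intro h
      rw [h, M.closure_empty, M.loops_eq_empty] at hpcl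
      exact hpcl
    obtain ⟨q, hq, hmin'⟩ := Set.exists_min_image (C \ {p}) w (Set.toFinite _) hne
    have : p ∈ {i | w q ≤ w i} :=
      ((hw (w q)).closure ▸ M.closure_subset_closure (Y := {i | w q ≤ w i}) hmin') hpcl
    exact ⟨p, hp, q, hq.1, fun h => hq.2 h.symm, le_antisymm (hmin q hq.1) this, hmin⟩

theorem add_const_mem_bergmanFan (hE : M.E = univ) {w : E → ℝ} (hw : w ∈ bergmanFan M) (c : ℝ) :
    (fun i => w i + c) ∈ bergmanFan M := by
  rw [mem_bergmanFan_iff hE] at hw ⊢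
  intro t
  convert hw (t - c) using 2
  ext i
  exact (sub_le_iff_le_add (a := t) (b := w i) (c := c)).symm

omit [M.Loopless] in
theorem dotProduct_swap (w : E → ℝ) {B : Set E} {j k : E} (hj : j ∉ B) (hk : k ∈ B) :
    w ⬝ᵥ incidenceVector (insert j (B \ {k})) = w ⬝ᵥ incidenceVector B + w j - w k := by
  classical
  have : incidenceVector (insert j (B \ {k})) =
      incidenceVector B + Pi.single j 1 - Pi.single k 1 := by
    have hjk : j ≠ k := fun h => hj (h ▸ hk)
    funext i
    by_cases hij : i = j
    · subst hij
      simp [incidenceVector, hj, hjk]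
    by_cases hik : i = k
    · subst hik
      simp [incidenceVector, hk, hij]
    · simp [incidenceVector, hij, hik, Set.indicator_apply]
  rw [this, dotProduct_sub, dotProduct_add]
  simp

/-- A basis of largest weight among those which contain a given element spans all superlevel sets
of the weight, if this lies in the Bergman fan. -/
theorem exists_isBase_spanning_superlevel (hE : M.E = univ) {w : E → ℝ} (hw : w ∈ bergmanFan M)
    (i : E) : ∃ B, M.IsBase B ∧ i ∈ B ∧
      ∀ t, {j | t ≤ w j} ⊆ M.closure (B ∩ {j | t ≤ w j}) := by
  have hi : M.Indep {i} := (Matroid.isNonloop_of_loopless (by simp [hE])).indep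
  obtain ⟨B₀, hB₀, hiB₀⟩ := hi.exists_isBase_superset
  obtain ⟨B, ⟨hB, hiB⟩, hmax⟩ := Set.exists_max_image {B | M.IsBase B ∧ i ∈ B}
    (fun B => w ⬝ᵥ incidenceVector B) (Set.toFinite _) ⟨B₀, hB₀, by simpa using hiB₀⟩
  refine ⟨B, hB, hiB, fun t j hj => ?_⟩
  have hj : t ≤ w j := hj
  by_contra hjcl
  have hjB : j ∉ B := fun h => hjcl (M.mem_closure_of_mem ⟨h, hj⟩ (by simp [hE]))
  have hC := hB.fundCircuit_isCircuit (x := j) (by simp [hE]) hjB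
  have hCB := M.fundCircuit_subset_insert j B
  -- the fundamental circuit of `j` leaves the superlevel set, even outside `i`
  have hk : ∃ k ∈ M.fundCircuit j B, k ≠ i ∧ w k < t := by
    by_contra! hcon
    have hall : ∀ k ∈ M.fundCircuit j B, t ≤ w k := by
      intro k hk
      by_cases hki : k = i
      · obtain ⟨p, hp, q, hq, hpq, hwpq, hmin⟩ := hw _ hC
        by_cases hpi : p = i
        · exact (hcon q hq fun h => hpq (hpi.trans h.symm)).trans (hwpq ▸ hmin k hk)
        · exact (hcon p hp hpi).trans (hmin k hk)
      · exact hcon k hk hki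
    refine hjcl (M.closure_subset_closure ?_
      (hC.mem_closure_sdiff_singleton_of_mem (M.mem_fundCircuit j B)))
    rintro k ⟨hk, hkj⟩
    exact ⟨(hCB hk).resolve_left hkj, hall k hk⟩
  obtain ⟨k, hkC, hki, hkt⟩ := hk
  have hkB : k ∈ B := (hCB hkC).resolve_left fun h => by
    rw [h] at hkt
    exact absurd hj hkt.not_ge
  have hind := (hB.indep.mem_fundCircuit_iff (by rw [hB.closure_eq, hE]; trivial) hjB).1 hkC
  have hbase := hB.exchange_isBase_of_indep' hkB hjB hind
  have hjk : j ≠ k := fun h => hjB (h ▸ hkB)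
  rw [← insert_sdiff_singleton_comm hjk] at hbase
  have := hmax (insert j (B \ {k})) ⟨hbase, Or.inr ⟨hiB, fun h => hki h.symm⟩⟩
  rw [dotProduct_swap w hjB hkB] at this
  linarith

end Bergman

/-! ### Faces of the matroid polytope -/

section Polytope

variable {E : Type*} [Fintype E] {M : Matroid E}

theorem mem_maxFace_iff {P : Set (E → ℝ)} {w x : E → ℝ} :
    x ∈ maxFace P w ↔ x ∈ P ∧ ∀ y ∈ P, w ⬝ᵥ y ≤ w ⬝ᵥ x := Iff.rfl

omit [Fintype E] in
theorem incidenceVector_mem_matroidPolytope {B : Set E} (hB : M.IsBase B) :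
    incidenceVector B ∈ matroidPolytope M := subset_convexHull _ _ ⟨B, hB, rfl⟩

theorem dotProduct_le_of_mem_matroidPolytope {w : E → ℝ} {c : ℝ}
    (h : ∀ B, M.IsBase B → w ⬝ᵥ incidenceVector B ≤ c) {x : E → ℝ} (hx : x ∈ matroidPolytope M) :
    w ⬝ᵥ x ≤ c := by
  have hconv : Convex ℝ {x : E → ℝ | w ⬝ᵥ x ≤ c} :=
    convex_halfSpace_le ⟨dotProduct_add w, fun c x => dotProduct_smul c w x⟩ c
  refine convexHull_min ?_ hconv hx
  rintro _ ⟨B, hB, rfl⟩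
  exact h B hB

theorem incidenceVector_dotProduct (A B : Set E) :
    incidenceVector A ⬝ᵥ incidenceVector B = ((B ∩ A).ncard : ℝ) := by
  classical
  have : ∀ i, incidenceVector A i * incidenceVector B i = if i ∈ B ∩ A then (1 : ℝ) else 0 := by
    intro i
    by_cases hA : i ∈ A <;> by_cases hB : i ∈ B <;> simp [incidenceVector, hA, hB]
  rw [dotProduct, Finset.sum_congr rfl fun i _ => this i, Finset.sum_boole,
    Set.ncard_eq_toFinset_card']
  congr 2
  ext i
  simp

/-- All points of the matroid polytope have the same coordinate sum. -/
theorem one_dotProduct_eq_of_mem_matroidPolytope {x y : E → ℝ} (hx : x ∈ matroidPolytope M)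
    (hy : y ∈ matroidPolytope M) : (1 : E → ℝ) ⬝ᵥ x = 1 ⬝ᵥ y := by
  obtain ⟨B₀, hB₀⟩ := M.exists_isBase
  have h1 : (1 : E → ℝ) = incidenceVector univ := by
    funext i
    simp [incidenceVector]
  have hB : ∀ B, M.IsBase B → (1 : E → ℝ) ⬝ᵥ incidenceVector B = (B₀.ncard : ℝ) := by
    intro B hB
    rw [h1, incidenceVector_dotProduct, inter_univ, hB.ncard_eq_ncard_of_isBase hB₀]
  have key : ∀ z ∈ matroidPolytope M, (1 : E → ℝ) ⬝ᵥ z = (B₀.ncard : ℝ) := by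
    intro z hz
    refine le_antisymm (dotProduct_le_of_mem_matroidPolytope (fun B h => (hB B h).le) hz) ?_
    have := dotProduct_le_of_mem_matroidPolytope (w := -1) (c := -(B₀.ncard : ℝ))
      (fun B h => by rw [neg_dotProduct, hB B h]) hz
    rw [neg_dotProduct] at this
    linarith
  rw [key x hx, key y hy]

theorem incidenceVector_mem_maxFace {A B : Set E} (hB : M.IsBase B) (hA : A ⊆ M.closure (B ∩ A)) :
    incidenceVector B ∈ maxFace (matroidPolytope M) (incidenceVector A) := by
  rw [mem_maxFace_iff]
  refine ⟨incidenceVector_mem_matroidPolytope hB, fun y hy =>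
    dotProduct_le_of_mem_matroidPolytope (fun B' hB' => ?_) hy⟩
  rw [incidenceVector_dotProduct, incidenceVector_dotProduct, Nat.cast_le]
  have hbasis : M.IsBasis (B ∩ A) A :=
    (hB.indep.subset inter_subset_left).isBasis_of_subset_of_subset_closure inter_subset_right hA
  have h1 := (hB'.indep.subset inter_subset_left : M.Indep (B' ∩ A)).encard_le_eRk_of_subset
    inter_subset_right
  rw [← hbasis.encard_eq_eRk, ← (Set.toFinite (B' ∩ A)).cast_ncard_eq,
    ← (Set.toFinite (B ∩ A)).cast_ncard_eq] at h1
  exact_mod_cast h1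

/-- A weight lies in the Bergman fan if every element is contained in a basis of maximal weight. -/
theorem mem_bergmanFan_of_forall_exists_isBase [M.Loopless] (hE : M.E = univ) {w : E → ℝ}
    (h : ∀ i, ∃ B, M.IsBase B ∧ i ∈ B ∧ incidenceVector B ∈ maxFace (matroidPolytope M) w) :
    w ∈ bergmanFan M := by
  rw [mem_bergmanFan_iff hE]
  intro t
  rw [Matroid.isFlat_iff_closure_eq]
  refine subset_antisymm (fun i hi => ?_) (M.subset_closure _ (by simp [hE]))
  by_contra hiX
  have hiX : w i < t := not_le.1 hiX
  obtain ⟨B, hB, hiB, hmax⟩ := h i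
  obtain ⟨j, hj, hjcl⟩ : ∃ j, t ≤ w j ∧ j ∉ M.closure (B \ {i}) := by
    by_contra! hcon
    exact hB.indep.notMem_closure_sdiff_of_mem hiB
      (M.closure_subset_closure_of_subset_closure hcon hi)
  have hji : j ≠ i := fun h => by
    rw [h] at hj
    linarith
  have hjB : j ∉ B := fun h => hjcl (M.mem_closure_of_mem ⟨h, hji⟩ (by simp [hE]))
  have hbase := hB.exchange_base_of_notMem_closure hiB hjcl (by simp [hE])
  have := (mem_maxFace_iff.1 hmax).2 _ (incidenceVector_mem_matroidPolytope hbase)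
  rw [dotProduct_swap w hjB hiB] at this
  linarith

end Polytope

/-! ### The nested set fan refines the Bergman fan -/

section NestedFan

variable {E : Type*} [Fintype E] {M : Matroid E} [M.Loopless] {G S : Set (FlatLattice M)}

theorem SplitsFlats.sum_mem_bergmanFan (hE : M.E = univ) (hG : SplitsFlats M G)
    {T : Finset (FlatLattice M)} (hT : IsNested G (T : Set (FlatLattice M)))
    {a : FlatLattice M → ℝ} (ha : ∀ g ∈ T, 0 < a g) :
    ∑ g ∈ T, a g • flatVector M g ∈ bergmanFan M := by
  classical
  rw [mem_bergmanFan_iff hE]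
  intro t
  rcases lt_or_ge 0 t with ht | ht
  · obtain ⟨Y, hY, -⟩ := hG.superlevel hT (fun g hg => (ha g hg).le) ht
    exact hY ▸ Y.2
  · have : {i | t ≤ (∑ g ∈ T, a g • flatVector M g) i} = M.E := by
      rw [hE, eq_univ_iff_forall]
      intro i
      change t ≤ _
      rw [sum_flatVector_apply]
      exact ht.trans (Finset.sum_nonneg fun g hg => (ha g (Finset.mem_filter.1 hg).1).le)
    rw [this]
    exact M.ground_isFlat

/-- The vectors of a nested set attain their maxima over the matroid polytope at a common basis,
which can be chosen to contain any given element. -/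
theorem SplitsFlats.exists_isBase_spanning (hE : M.E = univ) (hG : SplitsFlats M G)
    {T : Finset (FlatLattice M)} (hT : IsNested G (T : Set (FlatLattice M))) (i : E) :
    ∃ B, M.IsBase B ∧ i ∈ B ∧ ∀ g ∈ T, g.1 ⊆ M.closure (B ∩ g.1) := by
  have ha : ∀ g ∈ T, (0 : ℝ) < (fun _ => 1 : FlatLattice M → ℝ) g := fun _ _ => one_pos
  obtain ⟨B, hB, hiB, hspan⟩ :=
    exists_isBase_spanning_superlevel hE (hG.sum_mem_bergmanFan hE hT ha) i
  refine ⟨B, hB, hiB, fun g hg e he => ?_⟩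
  obtain ⟨t, -, Y, hY, hgY⟩ := (hG.mem_iff_factor_superlevel hT ha g).1 hg
  have h1 := hspan t
  rw [← hY] at h1
  exact M.closure_subset_closure (inter_subset_inter_left _ inter_subset_left)
    (hG.mem_closure Y g hgY _ inter_subset_right e he (h1 (hgY.1.2 he)))

omit [M.Loopless] in
theorem dotProduct_sum_add_const (T : Finset (FlatLattice M)) (a : FlatLattice M → ℝ) (c : ℝ)
    (x : E → ℝ) : (fun i => (∑ g ∈ T, a g • flatVector M g) i + c) ⬝ᵥ x =
      ∑ g ∈ T, a g * (flatVector M g ⬝ᵥ x) + c * ((1 : E → ℝ) ⬝ᵥ x) := by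
  have : (fun i => (∑ g ∈ T, a g • flatVector M g) i + c) =
      ∑ g ∈ T, a g • flatVector M g + c • (1 : E → ℝ) := by
    funext i
    simp
  rw [this, add_dotProduct, sum_dotProduct, smul_dotProduct]
  simp [smul_dotProduct]

omit [M.Loopless] in
theorem sum_mem_maxFace {x : E → ℝ} (hx : x ∈ matroidPolytope M) {T : Finset (FlatLattice M)}
    {a : FlatLattice M → ℝ} (ha : ∀ g ∈ T, 0 ≤ a g)
    (hmax : ∀ g ∈ T, x ∈ maxFace (matroidPolytope M) (flatVector M g)) (c : ℝ) :
    x ∈ maxFace (matroidPolytope M) (fun i => (∑ g ∈ T, a g • flatVector M g) i + c) := by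
  refine mem_maxFace_iff.2 ⟨hx, fun y hy => ?_⟩
  rw [dotProduct_sum_add_const, dotProduct_sum_add_const,
    one_dotProduct_eq_of_mem_matroidPolytope hy hx, add_le_add_iff_right]
  exact Finset.sum_le_sum fun g hg =>
    mul_le_mul_of_nonneg_left ((mem_maxFace_iff.1 (hmax g hg)).2 y hy) (ha g hg)

/-- A point of the polytope that maximizes a positive combination of the vectors of a nested set
maximizes each of these vectors, because they all attain their maxima at a common basis. -/
theorem SplitsFlats.maxFace_subset [Nonempty E] (hE : M.E = univ) (hG : SplitsFlats M G)
    {T : Finset (FlatLattice M)} (hT : IsNested G (T : Set (FlatLattice M)))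
    {a : FlatLattice M → ℝ} (ha : ∀ g ∈ T, 0 < a g) (c : ℝ) {g : FlatLattice M} (hg : g ∈ T) :
    maxFace (matroidPolytope M) (fun i => (∑ g ∈ T, a g • flatVector M g) i + c) ⊆
      maxFace (matroidPolytope M) (flatVector M g) := by
  intro x hx
  rw [mem_maxFace_iff] at hx
  obtain ⟨B, hB, -, hspan⟩ := hG.exists_isBase_spanning hE hT (Classical.arbitrary E)
  have hBP := incidenceVector_mem_matroidPolytope hB
  have hmax : ∀ h ∈ T, ∀ y ∈ matroidPolytope M,
      flatVector M h ⬝ᵥ y ≤ flatVector M h ⬝ᵥ incidenceVector B := fun h hh =>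
    (mem_maxFace_iff.1 (incidenceVector_mem_maxFace hB (hspan h hh))).2
  have hsum := hx.2 _ hBP
  rw [dotProduct_sum_add_const, dotProduct_sum_add_const,
    one_dotProduct_eq_of_mem_matroidPolytope hBP hx.1, add_le_add_iff_right] at hsum
  have hle : ∀ h ∈ T, a h * (flatVector M h ⬝ᵥ x) ≤
      a h * (flatVector M h ⬝ᵥ incidenceVector B) := fun h hh =>
    mul_le_mul_of_nonneg_left (hmax h hh x hx.1) (ha h hh).le
  have heq := (Finset.sum_eq_sum_iff_of_le hle).1 (le_antisymm (Finset.sum_le_sum hle) hsum) g hg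
  have heq := mul_left_cancel₀ (ha g hg).ne' heq
  exact mem_maxFace_iff.2 ⟨hx.1, fun y hy => heq ▸ hmax g hg y hy⟩

/-- The cone of a nested set lies in the cone of the normal fan which contains one of its relatively
interior points. -/
theorem SplitsFlats.addLine_coneOver_subset_normalCone [Nonempty E] (hE : M.E = univ)
    (hG : SplitsFlats M G) {T : Finset (FlatLattice M)}
    (hT : IsNested G (T : Set (FlatLattice M))) {a : FlatLattice M → ℝ} (ha : ∀ g ∈ T, 0 < a g)
    (c : ℝ) : addLine (coneOver (flatVector M) (T : Set (FlatLattice M))) ⊆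
      normalCone (matroidPolytope M) (fun i => (∑ g ∈ T, a g • flatVector M g) i + c) := by
  rintro _ ⟨_, hz, d, rfl⟩ x hx
  obtain ⟨U, hUT, b, hb, rfl⟩ := mem_coneOver_iff.1 hz
  exact sum_mem_maxFace hx.1 (fun g hg => (hb g hg).le)
    (fun g hg => hG.maxFace_subset hE hT ha c (hUT hg) hx) d

omit [Fintype E] [M.Loopless] in
/-- The factors of the superlevel sets of a vector form a nested set. -/
theorem isNested_superlevel_factors (w : E → ℝ) :
    IsNested G {g | ∃ t > 0, ∃ Y : FlatLattice M, Y.1 = {i | t ≤ w i} ∧ g ∈ factors G Y} := by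
  refine ⟨fun g ⟨_, _, Y, _, hg⟩ => hg.1.1, fun T hTS hT hcard hmem => ?_⟩
  have hTS' : ∀ g ∈ T, ∃ t, ∃ Y : FlatLattice M, Y.1 = {i | t ≤ w i} ∧ g ∈ factors G Y :=
    fun g hg => by
      obtain ⟨t, -, h⟩ := hTS hg
      exact ⟨t, h⟩
  choose! t Y hY hgY using hTS'
  -- the member of `T` which belongs to the largest superlevel set absorbs the whole join
  obtain ⟨g, hg, hmin⟩ := Finset.exists_min_image T t (Finset.card_pos.1 (by omega))
  have hle : T.sup id ≤ Y g := Finset.sup_le fun h hh => (hgY h hh).1.2.trans (by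
    rw [flat_le_iff, hY h hh, hY g hg]
    exact fun i hi => (hmin h hh).trans hi)
  have hsup : T.sup id ≤ g := (hgY g hg).2 ⟨hmem, hle⟩ (Finset.le_sup (f := id) hg)
  obtain ⟨h, hh, hne⟩ := Finset.exists_mem_ne (by omega : 1 < T.card) g
  exact hT hh hg hne ((Finset.le_sup (f := id) hh).trans hsup)

omit [M.Loopless] in
theorem SplitsFlats.incidenceVector_mem_coneOver (hG : SplitsFlats M G) (X : FlatLattice M) :
    incidenceVector X.1 ∈ coneOver (flatVector M) (factors G X) := by
  classical
  rw [mem_coneOver_iff]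
  refine ⟨(Set.toFinite (factors G X)).toFinset, by simp, fun _ => 1, by simp, ?_⟩
  funext i
  rw [sum_flatVector_apply]
  by_cases hi : i ∈ X.1
  · obtain ⟨g, hg, hig⟩ := hG.exists_mem X i hi
    rw [Finset.sum_eq_single g]
    · simp [incidenceVector, hi]
    · intro h hh hne
      simp only [Finset.mem_filter, Finite.mem_toFinset] at hh
      exact absurd hig (Set.disjoint_left.1 (hG.disjoint X h hh.1 g hg hne) hh.2)
    · intro h
      exact absurd (by simpa using ⟨hg, hig⟩) h
  · rw [Finset.sum_eq_zero]
    · simp [incidenceVector, hi]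
    · intro h hh
      simp only [Finset.mem_filter, Finite.mem_toFinset] at hh
      exact absurd (hh.1.1.2 hh.2) hi

/-- Every vector of the Bergman fan is, up to a constant, a positive combination of the vectors of a
nested set. -/
theorem SplitsFlats.exists_eq_sum (hE : M.E = univ) (hG : SplitsFlats M G) {w : E → ℝ}
    (hw : w ∈ bergmanFan M) : ∃ T : Finset (FlatLattice M),
      IsNested G (T : Set (FlatLattice M)) ∧ ∃ a : FlatLattice M → ℝ, (∀ g ∈ T, 0 < a g) ∧
      ∃ c : ℝ, w = fun i => (∑ g ∈ T, a g • flatVector M g) i + c := by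
  obtain ⟨c, hc⟩ : ∃ c, ∀ i, c ≤ w i := by
    obtain ⟨c, hc⟩ := (Set.finite_range w).bddBelow
    exact ⟨c, fun i => hc ⟨i, rfl⟩⟩
  let w' : E → ℝ := fun i => w i + -c
  have hflat := (mem_bergmanFan_iff hE).1 (add_const_mem_bergmanFan hE hw (-c))
  have hmem : w' ∈ coneOver (flatVector M) {g | ∃ t > 0, ∃ Y : FlatLattice M,
      Y.1 = {i | t ≤ w' i} ∧ g ∈ factors G Y} := by
    refine mem_pointedCone_of_superlevel _ (fun i => ?_) fun t ht => ?_
    · change 0 ≤ w i + -c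
      linarith [hc i]
    · let Y : FlatLattice M := ⟨{i | t ≤ w' i}, hflat t⟩
      have hsub : factors G Y ⊆ {g | ∃ t > 0, ∃ Y : FlatLattice M,
          Y.1 = {i | t ≤ w' i} ∧ g ∈ factors G Y} := fun g hg => ⟨t, ht, Y, rfl, hg⟩
      exact coneOver_mono hsub (hG.incidenceVector_mem_coneOver Y)
  obtain ⟨T, hT, a, ha, hwT⟩ := mem_coneOver_iff.1 hmem
  refine ⟨T, (isNested_superlevel_factors w').subset hT, a, ha, c, ?_⟩
  rw [← hwT]
  simp [w']

theorem SplitsFlats.isSimplicialFan (hG : SplitsFlats M G) :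
    IsSimplicialFan (nestedSets G) (flatVector M) := by
  refine ⟨fun S hS => hG.linearIndepOn hS, fun S hS T hT => subset_antisymm ?_ (subset_inter
    (coneOver_mono inter_subset_left) (coneOver_mono inter_subset_right))⟩
  rintro w ⟨hwS, hwT⟩
  obtain ⟨S', hS', a, ha, rfl⟩ := mem_coneOver_iff.1 hwS
  obtain ⟨T', hT', b, hb, heq⟩ := mem_coneOver_iff.1 hwT
  obtain rfl := hG.eq_of_sum_eq (IsNested.subset hS hS') (IsNested.subset hT hT') ha hb heq
  exact mem_coneOver_iff.2 ⟨S', subset_inter hS' hT', a, ha, rfl⟩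

theorem SplitsFlats.sUnion_nestedFanCones (hE : M.E = univ) (hG : SplitsFlats M G) :
    ⋃₀ nestedFanCones M G = bergmanFan M := by
  apply subset_antisymm
  · rintro _ ⟨_, ⟨S, hS, rfl⟩, ⟨z, hz, c, rfl⟩⟩
    obtain ⟨T, hTS, a, ha, rfl⟩ := mem_coneOver_iff.1 hz
    exact add_const_mem_bergmanFan hE (hG.sum_mem_bergmanFan hE (IsNested.subset hS hTS) ha) c
  · intro w hw
    obtain ⟨T, hT, a, ha, c, rfl⟩ := hG.exists_eq_sum hE hw
    exact ⟨_, ⟨T, hT, rfl⟩, _, mem_coneOver_iff.2 ⟨T, subset_rfl, a, ha, rfl⟩, c, rfl⟩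

/-- The support of the Bergman fan contains the whole cone of the normal fan around each of its
points. -/
theorem SplitsFlats.mem_bergmanFan_of_mem_normalCone (hE : M.E = univ) (hG : SplitsFlats M G)
    {w w' : E → ℝ} (hw : w ∈ bergmanFan M) (hw' : w' ∈ normalCone (matroidPolytope M) w) :
    w' ∈ bergmanFan M := by
  obtain ⟨T, hT, a, ha, c, rfl⟩ := hG.exists_eq_sum hE hw
  refine mem_bergmanFan_of_forall_exists_isBase hE fun i => ?_
  obtain ⟨B, hB, hiB, hspan⟩ := hG.exists_isBase_spanning hE hT i
  exact ⟨B, hB, hiB, hw' (sum_mem_maxFace (incidenceVector_mem_matroidPolytope hB)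
    (fun g hg => (ha g hg).le) (fun g hg => incidenceVector_mem_maxFace hB (hspan g hg)) c)⟩

theorem SplitsFlats.refines (hE : M.E = univ) [Nonempty E] (hG : SplitsFlats M G) :
    Refines (nestedFanCones M G) (bergmanCones M) := by
  constructor
  · rintro _ ⟨S, hS, rfl⟩
    obtain ⟨T, rfl⟩ := (Set.toFinite S).exists_finset_coe
    have ha : ∀ g ∈ T, (0 : ℝ) < (fun _ => 1 : FlatLattice M → ℝ) g := fun _ _ => one_pos
    exact ⟨_, ⟨_, add_const_mem_bergmanFan hE (hG.sum_mem_bergmanFan hE hS ha) 0, rfl⟩,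
      hG.addLine_coneOver_subset_normalCone hE hS ha 0⟩
  · rintro _ ⟨w, hw, rfl⟩
    refine subset_antisymm (sUnion_subset fun a ha => ha.2) fun w' hw' => ?_
    obtain ⟨T, hT, a, ha, c, rfl⟩ :=
      hG.exists_eq_sum hE (hG.mem_bergmanFan_of_mem_normalCone hE hw hw')
    refine ⟨_, ⟨⟨T, hT, rfl⟩, fun z hz => ?_⟩, _, mem_coneOver_iff.2 ⟨T, subset_rfl, a, ha, rfl⟩,
      c, rfl⟩
    exact Subset.trans hw' (hG.addLine_coneOver_subset_normalCone hE hT ha c hz)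

end NestedFan

/-! ### Passage to the sphere -/

section Sphere

variable {E : Type*}

/-- The set `C + ℝ (1, …, 1)`, for the cone `C` over the vectors `v i`, `i ∈ S`, as a cone. -/
noncomputable def addLineCone {ι : Type*} (v : ι → E → ℝ) (S : Set ι) : PointedCone ℝ (E → ℝ) :=
  PointedCone.hull ℝ (v '' S) ⊔ PointedCone.ofSubmodule (Submodule.span ℝ {(1 : E → ℝ)})

theorem coe_addLineCone {ι : Type*} (v : ι → E → ℝ) (S : Set ι) :
    (addLineCone v S : Set (E → ℝ)) = addLine (coneOver v S) := by
  ext w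
  rw [SetLike.mem_coe, addLineCone, Submodule.mem_sup]
  constructor
  · rintro ⟨y, hy, z, hz, rfl⟩
    obtain ⟨c, rfl⟩ := Submodule.mem_span_singleton.1 hz
    exact ⟨y, hy, c, by funext; simp⟩
  · rintro ⟨y, hy, c, rfl⟩
    exact ⟨y, hy, c • 1, Submodule.mem_span_singleton.2 ⟨c, rfl⟩, by funext; simp⟩

/-- Modulo the line, a cone does not change if its generators are translated along the line and
scaled, and it only grows if generators are added. -/
theorem addLine_coneOver_subset {ι κ : Type*} {u : ι → E → ℝ} {v : κ → E → ℝ} {S : Set ι}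
    {T : Set κ} (h : ∀ i ∈ S, u i ∈ addLine (coneOver v T)) :
    addLine (coneOver u S) ⊆ addLine (coneOver v T) := by
  rw [← coe_addLineCone, ← coe_addLineCone, SetLike.coe_subset_coe, addLineCone]
  refine sup_le (Submodule.span_le.2 ?_) le_sup_right
  rintro _ ⟨i, hi, rfl⟩
  rw [coe_addLineCone]
  exact h i hi

theorem mem_addLine_coneOver {ι : Type*} {v : ι → E → ℝ} {S : Set ι} {i : ι} (hi : i ∈ S) {r : ℝ}
    (hr : 0 ≤ r) (m : ℝ) : (fun e => r * v i e + m) ∈ addLine (coneOver v S) :=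
  ⟨r • v i, PointedCone.smul_mem _ hr (Submodule.subset_span ⟨i, hi, rfl⟩), m, rfl⟩

variable [Fintype E]

theorem toZeroSumSphere_mem {w : E → ℝ} (hw : ∃ i j, w i ≠ w j) :
    toZeroSumSphere w ∈ zeroSumSphere E ∧
      ∃ r > 0, ∃ m, toZeroSumSphere w = fun i => r * w i + m := by
  obtain ⟨i, j, hij⟩ := hw
  have : Nonempty E := ⟨i⟩
  have hcard : (Fintype.card E : ℝ) ≠ 0 := Nat.cast_ne_zero.2 Fintype.card_ne_zero
  set x : E → ℝ := fun i => w i - (∑ j, w j) / Fintype.card E with hx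
  have hdef : toZeroSumSphere w = (√(∑ i, x i ^ 2))⁻¹ • x := rfl
  have hsum : ∑ i, x i = 0 := by
    simp only [hx, Finset.sum_sub_distrib, Finset.sum_const, Finset.card_univ, nsmul_eq_mul]
    field_simp
    ring
  have hpos : 0 < ∑ i, x i ^ 2 := by
    refine lt_of_le_of_ne (Finset.sum_nonneg fun i _ => sq_nonneg _) fun h => hij ?_
    have h0 := (Finset.sum_eq_zero_iff_of_nonneg fun i _ => sq_nonneg (x i)).1 h.symm
    have hi := pow_eq_zero_iff (two_ne_zero) |>.1 (h0 i (Finset.mem_univ _))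
    have hj := pow_eq_zero_iff (two_ne_zero) |>.1 (h0 j (Finset.mem_univ _))
    simp only [hx] at hi hj
    linarith
  have hs : 0 < √(∑ i, x i ^ 2) := Real.sqrt_pos.2 hpos
  rw [hdef]
  refine ⟨⟨?_, ?_⟩, _, inv_pos.2 hs, -((√(∑ i, x i ^ 2))⁻¹ * ((∑ j, w j) / Fintype.card E)), ?_⟩
  · simp only [Pi.smul_apply, smul_eq_mul, ← Finset.mul_sum, hsum, mul_zero]
  · simp only [Pi.smul_apply, smul_eq_mul, mul_pow, ← Finset.mul_sum, inv_pow,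
      Real.sq_sqrt hpos.le]
    exact inv_mul_cancel₀ hpos.ne'
  · funext i
    simp only [Pi.smul_apply, smul_eq_mul, hx]
    ring

variable {M : Matroid E}

theorem flatPoint_mem (hE : M.E = univ) {g : FlatLattice M} (hg : g.1.Nonempty) (hg' : g ≠ ⊤) :
    flatPoint M g ∈ zeroSumSphere E ∧
      ∃ r > 0, ∃ m, flatPoint M g = fun i => r * flatVector M g i + m := by
  refine toZeroSumSphere_mem ?_
  obtain ⟨i, hi⟩ := hg
  have : g.1 ≠ univ := fun h => hg' (Subtype.ext (h.trans hE.symm))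
  obtain ⟨j, hj⟩ := (Set.ne_univ_iff_exists_notMem _).1 this
  exact ⟨i, j, by simp [flatVector, incidenceVector, hi, hj]⟩

omit [Fintype E] in
theorem flatVector_top (hE : M.E = univ) : flatVector M (⊤ : FlatLattice M) = 1 := by
  have : (⊤ : FlatLattice M).1 = univ := hE
  funext i
  simp [flatVector, incidenceVector, this]

/-- The spherical simplex of `S` is cut out of the sphere by the cone of `S ∪ {⊤}`. -/
theorem sphericalSimplex_flatPoint (hE : M.E = univ) [Nonempty E] {S : Set (FlatLattice M)}
    (hS : ∀ g ∈ S, g.1.Nonempty) (hS' : ⊤ ∉ S) :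
    sphericalSimplex (flatPoint M) S =
      addLine (coneOver (flatVector M) (insert ⊤ S)) ∩ zeroSumSphere E := by
  have hpt := fun g (hg : g ∈ S) => flatPoint_mem hE (hS g hg) fun h => hS' (h ▸ hg)
  apply subset_antisymm
  · rintro w ⟨hw, hw'⟩
    refine ⟨addLine_coneOver_subset (fun g hg => ?_) (⟨w, hw, 0, by simp⟩ :
      w ∈ addLine (coneOver (flatPoint M) S)), hw'⟩
    obtain ⟨-, r, hr, m, h⟩ := hpt g hg
    rw [h]
    exact mem_addLine_coneOver (v := flatVector M) (mem_insert_of_mem ⊤ hg) hr.le m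
  · rintro w ⟨hw, hw'⟩
    refine ⟨?_, hw'⟩
    have hmem : w ∈ addLine (coneOver (flatPoint M) S) := by
      refine addLine_coneOver_subset (fun g hg => ?_) hw
      rcases hg with rfl | hg
      · rw [flatVector_top hE]
        exact ⟨0, Submodule.zero_mem _, 1, by funext; simp⟩
      · obtain ⟨-, r, hr, m, h⟩ := hpt g hg
        have : flatVector M g = fun i => r⁻¹ * flatPoint M g i + -(r⁻¹ * m) := by
          funext i
          rw [h]
          field_simp
          ring
        rw [this]
        exact mem_addLine_coneOver (v := flatPoint M) hg (inv_pos.2 hr).le _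
    obtain ⟨z, hz, c, rfl⟩ := hmem
    -- both `w` and `z` have coordinate sum zero, so that the translation is trivial
    obtain ⟨T, hT, a, -, hzT⟩ := mem_coneOver_iff.1 hz
    have hz0 : ∑ i, z i = 0 := by
      rw [hzT]
      simp only [Finset.sum_apply, Pi.smul_apply, smul_eq_mul]
      rw [Finset.sum_comm]
      refine Finset.sum_eq_zero fun g hg => ?_
      rw [← Finset.mul_sum, (hpt g (hT hg)).1.1, mul_zero]
    have hc := hw'.1
    rw [Finset.sum_add_distrib, hz0, zero_add, Finset.sum_const, Finset.card_univ, nsmul_eq_mul,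
      mul_eq_zero] at hc
    have hc0 := hc.resolve_left (Nat.cast_ne_zero.2 Fintype.card_ne_zero)
    simpa [hc0] using hz

theorem linearIndepOn_flatPoint (hE : M.E = univ) {S : Set (FlatLattice M)}
    (hS : ∀ g ∈ S, g.1.Nonempty) (hS' : ⊤ ∉ S)
    (hind : LinearIndepOn ℝ (flatVector M) (insert ⊤ S)) : LinearIndepOn ℝ (flatPoint M) S := by
  classical
  have hpt := fun g (hg : g ∈ S) => (flatPoint_mem hE (hS g hg) fun h => hS' (h ▸ hg)).2
  choose! r hr m hm using hpt
  rw [linearIndepOn_iff'] at hind ⊢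
  intro T a hTS hsum g hg
  have htop : ⊤ ∉ T := fun h => hS' (hTS h)
  have hne : ∀ h ∈ T, h ≠ ⊤ := fun h hh he => htop (he ▸ hh)
  have := hind (insert ⊤ T) (fun h => if h = ⊤ then ∑ h ∈ T, a h * m h else a h * r h)
    (by rw [Finset.coe_insert]; exact insert_subset_insert hTS) ?_ g (Finset.mem_insert_of_mem hg)
  · rw [if_neg (hne g hg)] at this
    exact (mul_eq_zero.1 this).resolve_right (hr g (hTS hg)).ne'
  · rw [Finset.sum_insert htop, if_pos rfl, flatVector_top hE, Finset.sum_smul,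
      ← Finset.sum_add_distrib, ← hsum]
    refine Finset.sum_congr rfl fun h hh => ?_
    rw [if_neg (hne h hh), hm h (hTS hh)]
    funext i
    simp
    ring

theorem Refines.inter_right {V : Type*} {A B : Set (Set V)} (h : Refines A B) (X : Set V) :
    Refines {a' | ∃ a ∈ A, a' = a ∩ X} {b' | ∃ b ∈ B, b' = b ∩ X} := by
  constructor
  · rintro _ ⟨a, ha, rfl⟩
    obtain ⟨b, hb, hab⟩ := h.1 a ha
    exact ⟨_, ⟨b, hb, rfl⟩, inter_subset_inter_left _ hab⟩
  · rintro _ ⟨b, hb, rfl⟩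
    refine subset_antisymm (sUnion_subset fun a ha => ha.2) ?_
    rintro x ⟨hxb, hxX⟩
    rw [← h.2 b hb] at hxb
    obtain ⟨a, ⟨ha, hab⟩, hxa⟩ := hxb
    exact ⟨_, ⟨⟨a, ha, rfl⟩, inter_subset_inter_left _ hab⟩, hxa, hxX⟩

variable {G : Set (FlatLattice M)}

/-- The spherical simplices are the intersections of the cones of the nested set fan, modulo the
line, with the sphere. -/
theorem SplitsFlats.nestedSimplices_eq (hE : M.E = univ) [Nonempty E] (hG : SplitsFlats M G) :
    nestedSimplices M G = {D | ∃ C ∈ nestedFanCones M G, D = C ∩ zeroSumSphere E} := by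
  ext D
  constructor
  · rintro ⟨S, ⟨hS, hS'⟩, rfl⟩
    exact ⟨_, ⟨_, hS', rfl⟩, sphericalSimplex_flatPoint hE
      (fun g hg => hG.nonempty g (hS'.1 (Or.inr hg))) hS⟩
  · rintro ⟨_, ⟨S, hS, rfl⟩, rfl⟩
    have hS1 : IsNested G (insert ⊤ (S \ {⊤})) := by
      rw [insert_sdiff_singleton]
      exact IsNested.insert_top hS hG.top_mem
    refine ⟨S \ {⊤}, ⟨by simp, hS1⟩, ?_⟩
    rw [sphericalSimplex_flatPoint hE (fun g hg => hG.nonempty g (hS.1 hg.1)) (by simp),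
      insert_sdiff_singleton]
    congr 1
    refine subset_antisymm (addLine_coneOver_subset fun g hg => ?_)
      (addLine_coneOver_subset fun g hg => ?_)
    · simpa using mem_addLine_coneOver (v := flatVector M) (Or.inr hg : g ∈ insert ⊤ S)
        zero_le_one 0
    · rcases hg with rfl | hg
      · rw [flatVector_top hE]
        exact ⟨0, Submodule.zero_mem _, 1, by funext; simp⟩
      · simpa using mem_addLine_coneOver (v := flatVector M) hg zero_le_one 0

omit [Fintype E] in
theorem addLine_coneOver_inter (hE : M.E = univ) {S T : Set (FlatLattice M)} (hS : ⊤ ∈ S)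
    (hT : ⊤ ∈ T) (h : coneOver (flatVector M) S ∩ coneOver (flatVector M) T =
      coneOver (flatVector M) (S ∩ T)) :
    addLine (coneOver (flatVector M) S) ∩ addLine (coneOver (flatVector M) T) =
      addLine (coneOver (flatVector M) (S ∩ T)) := by
  -- the cones contain `(1, …, 1)`, so that a large multiple of it moves a common point into both
  have hshift : ∀ {U : Set (FlatLattice M)}, ⊤ ∈ U → ∀ z ∈ coneOver (flatVector M) U, ∀ d ≥ 0,
      (fun i => z i + d) ∈ coneOver (flatVector M) U := by
    intro U hU z hz d hd
    have h1 : flatVector M ⊤ ∈ coneOver (flatVector M) U := Submodule.subset_span ⟨_, hU, rfl⟩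
    rw [flatVector_top hE] at h1
    have h2 : (fun i => z i + d) = z + d • (1 : E → ℝ) := by
      funext i
      simp
    rw [h2]
    exact Submodule.add_mem _ hz (PointedCone.smul_mem _ hd h1)
  apply subset_antisymm
  · rintro w ⟨⟨x, hx, c, rfl⟩, ⟨y, hy, d, hyd⟩⟩
    refine ⟨fun i => x i + (c + (|c| + |d|)), ?_, -(|c| + |d|), by funext; ring⟩
    rw [← h]
    refine ⟨hshift hS x hx _ ?_, ?_⟩
    · linarith [neg_abs_le c, abs_nonneg d]
    · have : (fun i => x i + (c + (|c| + |d|))) = fun i => y i + (d + (|c| + |d|)) := by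
        funext i
        have : x i + c = y i + d := congrFun hyd i
        linarith
      rw [this]
      exact hshift hT y hy _ (by linarith [neg_abs_le d, abs_nonneg c])
  · rintro _ ⟨x, hx, c, rfl⟩
    rw [← h] at hx
    exact ⟨⟨x, hx.1, c, rfl⟩, ⟨x, hx.2, c, rfl⟩⟩

theorem SplitsFlats.isSphericalRealization [M.Loopless] (hE : M.E = univ) [Nonempty E]
    (hG : SplitsFlats M G) : IsSphericalRealization (nestedSetComplex G) (flatPoint M) := by
  have hne : ∀ S ∈ nestedSetComplex G, ∀ g ∈ S, g.1.Nonempty := fun S hS g hg =>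
    hG.nonempty g (hS.2.1 (Or.inr hg))
  refine ⟨fun S hS g hg => ?_, fun S hS => ?_, fun S hS T hT => ?_⟩
  · exact (flatPoint_mem hE (hne S hS g hg) fun h => hS.1 (h ▸ hg)).1
  · exact linearIndepOn_flatPoint hE (hne S hS) hS.1 (hG.linearIndepOn hS.2)
  · rw [sphericalSimplex_flatPoint hE (hne S hS) hS.1, sphericalSimplex_flatPoint hE (hne T hT) hT.1,
      sphericalSimplex_flatPoint hE (fun g hg => hne S hS g hg.1) fun h => hS.1 h.1,
      ← inter_inter_distrib_right, insert_inter_distrib, addLine_coneOver_inter hE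
      (mem_insert _ _) (mem_insert _ _) (hG.isSimplicialFan.inter_eq _ hS.2 _ hT.2)]

end Sphere

theorem theorem4p1 {E : Type*} [Fintype E] [Nonempty E] (M : Matroid E) (hE : M.E = Set.univ)
    (hM : M.Loopless) (G : Set (FlatLattice M)) (hG : IsBuildingSet G) :
    -- the nested set fan is a simplicial fan which, modulo the line, refines the Bergman fan
    (IsSimplicialFan (nestedSets (insert ⊤ G)) (flatVector M) ∧
      Refines (nestedFanCones M (insert ⊤ G)) (bergmanCones M) ∧
      ⋃₀ nestedFanCones M (insert ⊤ G) = bergmanFan M) ∧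
    -- its spherical version realizes the nested set complex and triangulates the Bergman complex
    (IsSphericalRealization (nestedSetComplex (insert ⊤ G)) (flatPoint M) ∧
      Refines (nestedSimplices M (insert ⊤ G)) (bergmanFaces M) ∧
      ⋃₀ nestedSimplices M (insert ⊤ G) = bergmanComplex M) := by
  have hsplit := hG.splitsFlats (by rw [hE]; exact univ_nonempty)
  refine ⟨⟨hsplit.isSimplicialFan, hsplit.refines hE, hsplit.sUnion_nestedFanCones hE⟩,
    hsplit.isSphericalRealization hE, ?_, ?_⟩
  · rw [hsplit.nestedSimplices_eq hE]
    exact (hsplit.refines hE).inter_right _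
  · rw [hsplit.nestedSimplices_eq hE, bergmanComplex, ← hsplit.sUnion_nestedFanCones hE]
    ext x
    constructor
    · rintro ⟨_, ⟨C, hC, rfl⟩, hx⟩
      exact ⟨⟨C, hC, hx.1⟩, hx.2⟩
    · rintro ⟨⟨C, hC, hx⟩, hx'⟩
      exact ⟨_, ⟨C, hC, rfl⟩, hx, hx'⟩
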